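/- A groupoid is a set with one binary operation. An IP loop is a loop with two-sided inverses satisfying $x^{-1}(xy) = y = (yx)x^{-1}$ for all $x,y$. A groupoid $G$ is locally embeddable into a class $\mathbf{M}$ of groupoids if for every finite subset $X \subseteq G$ there are $(H,*) \in \mathbf{M}$ and an injective map $f\colon X \to H$ such that $f(xy) = f(x)*f(y)$ for all $x,y \in X$ with $xy \in X$. Theorem. Every group is locally embeddable into the class of all finite IP loops. Equivalently, every group embeds (by an injective multiplicative homomorphism) into some ultraproduct of finite IP loops. -/

import Mathlib

universe u v w

/-- A groupoid (a set with one binary operation) is a quasigroup if all equations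
`a * x = b` and `y * a = b` have unique solutions. -/
structure IsQuasigroup (H : Type v) [Mul H] : Prop where
  existsUnique_mul_left : ∀ a b : H, ∃! x : H, a * x = b
  existsUnique_mul_right : ∀ a b : H, ∃! y : H, y * a = b

/-- A loop is a quasigroup with a two-sided unit. -/
structure IsLoop (H : Type v) [Mul H] : Prop extends IsQuasigroup H where
  exists_one : ∃ e : H, ∀ x : H, e * x = x ∧ x * e = x

/-- An IP loop is a loop with two-sided inverses `x⁻¹` satisfying
`x⁻¹ (x y) = y = (y x) x⁻¹`. -/
structure IsIPLoop (H : Type v) [Mul H] : Prop extends IsLoop H where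
  exists_inv : ∃ (e : H) (inv : H → H),
    (∀ x : H, e * x = x ∧ x * e = x) ∧
    (∀ x : H, inv x * x = e ∧ x * inv x = e) ∧
    (∀ x y : H, inv x * (x * y) = y ∧ (y * x) * inv x = y)

/-- The class of all finite IP loops. -/
def IsFiniteIPLoop (H : Type v) [Mul H] : Prop :=
  Finite H ∧ IsIPLoop H

/-- A groupoid `G` is locally embeddable into a class `M` of groupoids if every finite piece of
the multiplication table of `G` embeds into a member of `M`: for every finite `X ⊆ G` there are
`H` in `M` and an injection `f : X → H` with `f (x y) = f x * f y` for all `x, y ∈ X` such that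
`x y ∈ X`. -/
def LocallyEmbeddable (G : Type u) [Mul G] (M : (H : Type v) → [Mul H] → Prop) : Prop :=
  ∀ X : Finset G, ∃ (H : Type v) (_ : Mul H), M H ∧
    ∃ f : {x : G // x ∈ X} → H, Function.Injective f ∧
      ∀ (x y : {x : G // x ∈ X}) (h : x.1 * y.1 ∈ X), f ⟨x.1 * y.1, h⟩ = f x * f y

/-- The coordinatewise multiplication on the product of groupoids modulo a filter. For an
ultrafilter this is the ultraproduct. -/
instance filterProductMul {ι : Type w} (l : Filter ι) (H : ι → Type v) [∀ i, Mul (H i)] :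
    Mul (l.Product H) where
  mul := Quotient.map₂ (fun a b i => a i * b i) fun _ _ ha _ _ hb =>
    Filter.Eventually.mp ha (Filter.Eventually.mono hb fun _ h₂ h₁ => congrArg₂ (· * ·) h₁ h₂)

/-- `G` embeds, by an injective multiplicative map, into an ultraproduct of members of the
class `M`. -/
def EmbedsIntoUltraproduct (G : Type u) [Mul G] (M : (H : Type v) → [Mul H] → Prop) : Prop :=
  ∃ (ι : Type u) (U : Ultrafilter ι) (H : ι → Type v) (_ : ∀ i, Mul (H i)),
    (∀ i, M (H i)) ∧
      ∃ f : G →ₙ* (U : Filter ι).Product H, Function.Injective f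

/-!
An IP loop amounts to a ternary relation `a b c = 1` that is invariant under rotation and under
`(a, b, c) ↦ (c⁻¹, b⁻¹, a⁻¹)`, in which two entries determine the third
(`IPTripleSystem.isIPLoop`). Such a system can be altered locally by a Pasch switch: if
`(z x)⁻¹ (x y)⁻¹ (y z)⁻¹ = 1` holds, then this triple and the triples `x, y, (x y)⁻¹` and
`y, z, (y z)⁻¹` and `z, x, (z x)⁻¹` may be replaced by `x, y, z` and
`x, (z x)⁻¹, (x y)⁻¹` and the two analogues of the latter for `y` and `z`, since both quadruples
occupy the same cells of the multiplication table. After the switch `x y z = 1`. Switches for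
different relations can be done together as long as they do not compete for cells
(`IPTripleSystem.exists_switch`).

For a finite set `X` of group elements it remains to find a finite IP loop with elements `f x` such
that all relations `x y z = 1` among nontrivial elements of `X` and their inverses admit
simultaneous switches. The loop lives on `V × A`, where `V` is the space over `𝔽₂` with one basis
vector for each class `{x, x⁻¹}`, and `f x` lies over the basis vector of its class. The products
`x y` lie over sums of two basis vectors, so that the fibre of an element tells which role it plays
in a switch, and usually in which switch. Over three distinct nonzero vectors with sum zero the
relation is `a + b + c = 0`. Thus, for `x, y, z` in distinct classes, the sum of the fibre
coordinates of `x y`, `y z` and `z x` contains each coordinate twice and vanishes, as the switch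
requires. Inverses in the fibre over `p` are translations by a vector `s p` of order two, so that
`s` is linear and vanishes on the classes of involutions.

Relations with repeated entries involve squares. Here the freedom is used that products inside a
fibre may be prescribed by an arbitrary permutation (`fibredLoop`, `exists_perms`). A relation
`x x z = 1` with `z ≠ x` admits a switch if `x` and `x z` have the same square; a fixed vector of
order two serves for all of them. A relation `x x x = 1` admits a switch if the square of `x` has
order three; a different such square for each `x` keeps these switches apart. The only other
coincidence to be excluded is that of `x y y = 1` and `y x x = 1`, which in a group imply `x = y`.

The embedding into an ultraproduct follows by an ultrafilter on the finite subsets of the group that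
contains the upper sets.
-/

/-! ### IP loops as triple systems and Pasch switches -/

/-- An IP loop presented by the relation `rel a b c` meaning `a b c = 1`. In these terms the inverse
property says that the relation is invariant under rotation and under inversion with reversal of
the order. -/
structure IPTripleSystem (B : Type u) where
  /-- The unit. -/
  one : B
  /-- The inverse map. -/
  inv : B → B
  /-- The relation `a b c = 1`. -/
  rel : B → B → B → Prop
  inv_inv : ∀ a, inv (inv a) = a
  rot : ∀ {a b c}, rel a b c → rel b c a
  rev : ∀ {a b c}, rel a b c → rel (inv c) (inv b) (inv a)
  exists_rel : ∀ a b, ∃ c, rel a b c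
  rel_unique : ∀ {a b c d}, rel a b c → rel a b d → c = d
  rel_one : ∀ a, rel one a (inv a)

namespace IPTripleSystem

variable {B : Type u} (S : IPTripleSystem B)

/-- The element `c` with `a b c = 1`, that is, `(a b)⁻¹`. -/
noncomputable def third (a b : B) : B := (S.exists_rel a b).choose

theorem rel_third (a b : B) : S.rel a b (S.third a b) := (S.exists_rel a b).choose_spec

variable {S} in
theorem third_eq {a b c : B} (h : S.rel a b c) : S.third a b = c :=
  S.rel_unique (S.rel_third a b) h

theorem inv_one : S.inv S.one = S.one := by
  have h := S.rev (S.rel_one S.one)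
  rw [S.inv_inv] at h
  have h' := S.rel_one (S.inv S.one)
  rw [S.inv_inv] at h'
  exact S.rel_unique h h'

/-- The multiplication of the IP loop presented by a triple system. -/
noncomputable abbrev toMul : Mul B := ⟨fun a b => S.inv (S.third a b)⟩

theorem rel_right_one (a : B) : S.rel a S.one (S.inv a) := by
  have h := S.rot (S.rot (S.rel_one (S.inv a)))
  rwa [S.inv_inv] at h

theorem rel_inv_right (a : B) : S.rel a (S.inv a) S.one := S.rot (S.rel_one a)

theorem rel_inv_left (a : B) : S.rel (S.inv a) a S.one := by
  have h := S.rel_inv_right (S.inv a)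
  rwa [S.inv_inv] at h

theorem isIPLoop : @IsIPLoop B S.toMul := by
  let _ : Mul B := S.toMul
  have mul_def : ∀ a b : B, a * b = S.inv (S.third a b) := fun _ _ => rfl
  have hone : ∀ x : B, S.one * x = x ∧ x * S.one = x := fun x => by
    constructor
    · rw [mul_def, third_eq (S.rel_one x), S.inv_inv]
    · rw [mul_def, third_eq (S.rel_right_one x), S.inv_inv]
  have hinv : ∀ x y : B, S.inv x * (x * y) = y ∧ (y * x) * S.inv x = y := fun x y => by
    constructor
    · rw [mul_def, mul_def, third_eq (S.rot (S.rot (S.rev (S.rel_third x y)))), S.inv_inv]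
    · rw [mul_def, mul_def, third_eq (S.rev (S.rel_third y x)), S.inv_inv]
  have hinv' : ∀ x y : B, x * (S.inv x * y) = y ∧ (y * S.inv x) * x = y := fun x y => by
    have h := hinv (S.inv x) y
    rwa [S.inv_inv] at h
  refine { existsUnique_mul_left := fun a b => ⟨S.inv a * b, (hinv' a b).1, ?_⟩
           existsUnique_mul_right := fun a b => ⟨b * S.inv a, (hinv' a b).2, ?_⟩
           exists_one := ⟨S.one, hone⟩
           exists_inv := ⟨S.one, S.inv, hone, fun x => ⟨?_, ?_⟩, hinv⟩ }
  · rintro x rfl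
    exact ((hinv a x).1).symm
  · rintro x rfl
    exact ((hinv a x).2).symm
  · rw [mul_def, third_eq (S.rel_inv_left x), S.inv_one]
  · rw [mul_def, third_eq (S.rel_inv_right x), S.inv_one]

/-- Transport of a triple system along a bijection. -/
def map {B' : Type v} (φ : B ≃ B') : IPTripleSystem B' where
  one := φ S.one
  inv a := φ (S.inv (φ.symm a))
  rel a b c := S.rel (φ.symm a) (φ.symm b) (φ.symm c)
  inv_inv a := by simp [S.inv_inv]
  rot h := S.rot h
  rev h := by simpa using S.rev h
  exists_rel a b := ⟨φ (S.third (φ.symm a) (φ.symm b)), by simpa using S.rel_third _ _⟩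
  rel_unique h h' := φ.symm.injective (S.rel_unique h h')
  rel_one a := by simpa using S.rel_one (φ.symm a)

/-- Exchange of a set `R` of triples of an IP loop for another set `N` of triples that occupies the
same cells of the multiplication table. -/
def exchange (R N : B → B → B → Prop)
    (hR : ∀ {a b c}, R a b c → S.rel a b c)
    (hRrot : ∀ {a b c}, R a b c → R b c a) (hNrot : ∀ {a b c}, N a b c → N b c a)
    (hRrev : ∀ {a b c}, R a b c → R (S.inv c) (S.inv b) (S.inv a))
    (hNrev : ∀ {a b c}, N a b c → N (S.inv c) (S.inv b) (S.inv a))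
    (hRN : ∀ {a b c}, R a b c → ∃ d, N a b d) (hNR : ∀ {a b c}, N a b c → ∃ d, R a b d)
    (hN : ∀ {a b c d}, N a b c → N a b d → c = d)
    (hone : ∀ {b c}, ¬ R S.one b c) : IPTripleSystem B where
  one := S.one
  inv := S.inv
  rel a b c := (S.rel a b c ∧ ¬ R a b c) ∨ N a b c
  inv_inv := S.inv_inv
  rot := by
    rintro a b c (⟨h, h'⟩ | h)
    · exact Or.inl ⟨S.rot h, fun h'' => h' (hRrot (hRrot h''))⟩
    · exact Or.inr (hNrot h)
  rev := by
    rintro a b c (⟨h, h'⟩ | h)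
    · refine Or.inl ⟨S.rev h, fun h'' => h' ?_⟩
      simpa only [S.inv_inv] using hRrev h''
    · exact Or.inr (hNrev h)
  exists_rel a b := by
    by_cases h : R a b (S.third a b)
    · obtain ⟨d, hd⟩ := hRN h
      exact ⟨d, Or.inr hd⟩
    · exact ⟨_, Or.inl ⟨S.rel_third a b, h⟩⟩
  rel_unique := by
    have key : ∀ {a b c d}, S.rel a b c ∧ ¬ R a b c → ¬ N a b d := by
      rintro a b c d ⟨h, h'⟩ hd
      obtain ⟨e, he⟩ := hNR hd
      exact h' (S.rel_unique (hR he) h ▸ he)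
    rintro a b c d (h | h) (h' | h')
    · exact S.rel_unique h.1 h'.1
    · exact absurd h' (key h)
    · exact absurd h (key h')
    · exact hN h h'
  rel_one a := Or.inl ⟨S.rel_one a, hone⟩

variable {C : Type w} [InvolutiveInv C]

section Switch

variable (P : C → C → C → Prop) (f : C → B)

/-- The triples removed by the switches: for every relation `x y z = 1` those containing the pairs
`x, y` and `y, z` and `z, x`, and the triple `(z x)⁻¹, (x y)⁻¹, (y z)⁻¹`. -/
inductive Removed : B → B → B → Prop
  | fst {x y z} (h : P x y z) : Removed (f x) (f y) (S.third (f x) (f y))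
  | snd {x y z} (h : P x y z) : Removed (f y) (S.third (f x) (f y)) (f x)
  | trd {x y z} (h : P x y z) : Removed (S.third (f x) (f y)) (f x) (f y)
  | opp {x y z} (h : P x y z) :
      Removed (S.third (f z) (f x)) (S.third (f x) (f y)) (S.third (f y) (f z))

/-- The triples inserted by the switches: for every relation `x y z = 1` the triple `x, y, z` and
the rotations of `x, (z x)⁻¹, (x y)⁻¹`. -/
inductive Inserted : B → B → B → Prop
  | main {x y z} (h : P x y z) : Inserted (f x) (f y) (f z)
  | fst {x y z} (h : P x y z) : Inserted (f x) (S.third (f z) (f x)) (S.third (f x) (f y))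
  | snd {x y z} (h : P x y z) : Inserted (S.third (f z) (f x)) (S.third (f x) (f y)) (f x)
  | trd {x y z} (h : P x y z) : Inserted (S.third (f x) (f y)) (f x) (S.third (f z) (f x))

variable {P f} in
/-- Pasch switches in an IP loop impose the relations `P` on the elements `f x`: it is enough that
the four triples to be removed for one relation are indeed triples of the loop, and that different
relations do not compete for a cell of the multiplication table. -/
theorem exists_switch
    (hrot : ∀ {x y z}, P x y z → P y z x) (hrev : ∀ {x y z}, P x y z → P z⁻¹ y⁻¹ x⁻¹)
    (huniq : ∀ {x y z z'}, P x y z → P x y z' → z = z')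
    (hf : Function.Injective f) (hfinv : ∀ x, f x⁻¹ = S.inv (f x)) (hf1 : ∀ x, f x ≠ S.one)
    (hopp : ∀ {x y z}, P x y z →
      S.rel (S.third (f z) (f x)) (S.third (f x) (f y)) (S.third (f y) (f z)))
    (hthird1 : ∀ {x y z}, P x y z → S.third (f x) (f y) ≠ S.one)
    (hsep : ∀ {x y z} (t : C), P x y z → f t ≠ S.third (f x) (f y))
    (hcell : ∀ {x y z x' y' z'}, P x y z → P x' y' z' →
      S.third (f z) (f x) = S.third (f z') (f x') →
      S.third (f x) (f y) = S.third (f x') (f y') → x = x') :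
    ∃ S' : IPTripleSystem B, S'.one = S.one ∧ S'.inv = S.inv ∧
      ∀ {x y z}, P x y z → S'.rel (f x) (f y) (f z) := by
  have hthird : ∀ x y, S.inv (S.third (f x) (f y)) = S.third (f y⁻¹) (f x⁻¹) := fun x y => by
    refine (third_eq ?_).symm
    rw [hfinv, hfinv]
    exact S.rot (S.rev (S.rel_third _ _))
  -- One factor of a product and the product determine the other factor.
  have hcancel : ∀ {x y y'}, S.third (f x) (f y) = S.third (f x) (f y') → y = y' := by
    intro x y y' h
    have h1 := S.rot (S.rot (S.rel_third (f x) (f y)))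
    have h2 := S.rot (S.rot (S.rel_third (f x) (f y')))
    rw [h] at h1
    exact hf (S.rel_unique h1 h2)
  have hcancel' : ∀ {x y y'}, S.third (f y) (f x) = S.third (f y') (f x) → y = y' := by
    intro x y y' h
    have h1 := S.rot (S.rel_third (f y) (f x))
    have h2 := S.rot (S.rel_third (f y') (f x))
    rw [h] at h1
    exact hf (S.rel_unique h1 h2)
  refine ⟨S.exchange (S.Removed P f) (S.Inserted P f) ?_ ?_ ?_ ?_ ?_ ?_ ?_ ?_ ?_, rfl, rfl,
    fun h => Or.inr (.main h)⟩
  · rintro _ _ _ (h | h | h | h)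
    · exact S.rel_third _ _
    · exact S.rot (S.rel_third _ _)
    · exact S.rot (S.rot (S.rel_third _ _))
    · exact hopp h
  · rintro _ _ _ (h | h | h | h)
    · exact .snd h
    · exact .trd h
    · exact .fst h
    · exact .opp (hrot h)
  · rintro _ _ _ (h | h | h | h)
    · exact .main (hrot h)
    · exact .snd h
    · exact .trd h
    · exact .fst h
  · rintro _ _ _ (h | h | h | h)
    · rw [hthird, ← hfinv, ← hfinv]; exact .trd (hrot (hrev h))
    · rw [hthird, ← hfinv, ← hfinv]; exact .snd (hrot (hrev h))
    · rw [hthird, ← hfinv, ← hfinv]; exact .fst (hrot (hrev h))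
    · rw [hthird, hthird, hthird]; exact .opp (hrot (hrev h))
  · rintro _ _ _ (h | h | h | h)
    · rw [← hfinv, ← hfinv, ← hfinv]; exact .main (hrev h)
    · rw [hthird, hthird, ← hfinv]; exact .snd (hrot (hrot (hrev h)))
    · rw [hthird, hthird, ← hfinv]; exact .fst (hrot (hrot (hrev h)))
    · rw [hthird, hthird, ← hfinv]; exact .trd (hrot (hrot (hrev h)))
  · rintro _ _ _ (h | h | h | h)
    · exact ⟨_, .main h⟩
    · exact ⟨_, .fst (hrot h)⟩
    · exact ⟨_, .trd h⟩
    · exact ⟨_, .snd h⟩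
  · rintro _ _ _ (h | h | h | h)
    · exact ⟨_, .fst h⟩
    · exact ⟨_, .snd (hrot (hrot h))⟩
    · exact ⟨_, .opp h⟩
    · exact ⟨_, .trd h⟩
  · intro a b c d h h'
    generalize ha : a = a' at h'
    generalize hb : b = b' at h'
    rcases h with h | h | h | h <;> rcases h' with h' | h' | h' | h'
    all_goals first
      | exact absurd ha (hsep _ h')
      | exact absurd ha (hsep _ (hrot (hrot h')))
      | exact absurd ha.symm (hsep _ h)
      | exact absurd ha.symm (hsep _ (hrot (hrot h)))
      | exact absurd hb (hsep _ h')
      | exact absurd hb (hsep _ (hrot (hrot h')))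
      | exact absurd hb.symm (hsep _ h)
      | exact absurd hb.symm (hsep _ (hrot (hrot h)))
      | skip
    · obtain rfl := hf ha
      obtain rfl := hf hb
      rw [huniq h h']
    · obtain rfl := hf ha
      obtain rfl := hcancel' hb
      rw [huniq (hrot (hrot h)) (hrot (hrot h'))]
    · rw [hcell h h' ha hb]
    · obtain rfl := hf hb
      obtain rfl := hcancel ha
      rw [huniq h h']
  · intro b c h
    generalize ha : S.one = a at h
    rcases h with h | h | h | h
    · exact hf1 _ ha.symm
    · exact hf1 _ ha.symm
    · exact hthird1 h ha.symm
    · exact hthird1 (hrot (hrot h)) ha.symm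

end Switch

end IPTripleSystem

/-! ### A loop on fibres over an elementary abelian 2-group -/

/-- The element `c` of the zero fibre with `(p, a) (p, b) (0, c) = 1` in the fibred loop. -/
def fibreSquare {V A : Type*} [AddCommGroup V] [AddCommGroup A] (s : V →+ A)
    (m : V → Equiv.Perm A) (p : V) (a b : A) : A :=
  m p (b + s p) - m p a

open Classical in
/-- An IP loop on `V × A`, for an elementary abelian `2`-group `V` and an abelian group `A`. The
zero fibre is the group `A`; the inverse of `(p, a)` with `p ≠ 0` is `(p, a + s p)`; over a line
`p + q + r = 0` with `p, q, r ≠ 0` the relation is `a + b + c = 0`; and the product of two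
elements of the same fibre is prescribed by arbitrary permutations `m p`. -/
noncomputable def fibredLoop {V : Type u} {A : Type v} [AddCommGroup V] [AddCommGroup A]
    (hV : ∀ p : V, p + p = 0) (s : V →+ A) (m : V → Equiv.Perm A) :
    IPTripleSystem (V × A) where
  one := 0
  inv x := if x.1 = 0 then (0, -x.2) else (x.1, x.2 + s x.1)
  rel x y z := x.1 + y.1 + z.1 = 0 ∧
    (x.1 = 0 → y.1 = 0 → x.2 + y.2 + z.2 = 0) ∧
    (x.1 = 0 → y.1 ≠ 0 → x.2 = fibreSquare s m y.1 y.2 z.2) ∧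
    (y.1 = 0 → x.1 ≠ 0 → y.2 = fibreSquare s m x.1 z.2 x.2) ∧
    (z.1 = 0 → x.1 ≠ 0 → z.2 = fibreSquare s m x.1 x.2 y.2) ∧
    (x.1 ≠ 0 → y.1 ≠ 0 → z.1 ≠ 0 → x.2 + y.2 + z.2 = 0)
  inv_inv := by
    have hs : ∀ p, s p + s p = 0 := fun p => by rw [← map_add, hV, map_zero]
    rintro ⟨p, a⟩
    by_cases hp : p = 0
    · simp [hp]
    · simp [hp, add_assoc, hs]
  rot := by
    have hV' : ∀ {p q : V}, p + q = 0 → q = p := fun {p q} h => by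
      rw [← hV p] at h; exact add_left_cancel h
    rintro ⟨p, a⟩ ⟨q, b⟩ ⟨r, c⟩ ⟨h, h1, h2, h3, h4, h5⟩
    dsimp only at *
    by_cases hp : p = 0
    · subst hp
      rw [zero_add] at h
      obtain rfl := hV' h
      by_cases hq : r = 0
      · subst hq
        have := h1 rfl rfl
        simp only [add_zero, true_and, ne_eq, not_true_eq_false, false_implies, true_implies,
          implies_true, and_true]
        rw [← this]; abel
      · simp [hq, hV, h2 rfl hq]
    · by_cases hq : q = 0
      · subst hq
        rw [add_zero] at h
        obtain rfl := hV' h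
        simp [hp, hV, h3 rfl hp]
      · by_cases hr : r = 0
        · subst hr
          rw [add_zero] at h
          obtain rfl := hV' h
          simp [hp, hV, h4 rfl hp]
        · refine ⟨by rw [← h]; abel, fun h' => absurd h' hq, fun h' => absurd h' hq,
            fun h' => absurd h' hr, fun h' => absurd h' hp, fun _ _ _ => ?_⟩
          rw [← h5 hp hq hr]; abel
  rev := by
    have hs : ∀ p, s p + s p = 0 := fun p => by rw [← map_add, hV, map_zero]
    have hV' : ∀ {p q : V}, p + q = 0 → q = p := fun {p q} h => by
      rw [← hV p] at h; exact add_left_cancel h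
    rintro ⟨p, a⟩ ⟨q, b⟩ ⟨r, c⟩ ⟨h, h1, h2, h3, h4, h5⟩
    dsimp only at *
    by_cases hp : p = 0
    · subst hp
      rw [zero_add] at h
      obtain rfl := hV' h
      by_cases hq : r = 0
      · subst hq
        have := h1 rfl rfl
        simp only [if_true, add_zero, true_and, ne_eq, not_true_eq_false, false_implies,
          true_implies, implies_true, and_true]
        rw [← neg_eq_zero, ← this]; abel
      · simp [hq, hV, h2 rfl hq, fibreSquare, add_assoc, hs]
    · by_cases hq : q = 0
      · subst hq
        rw [add_zero] at h
        obtain rfl := hV' h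
        simp [hp, hV, h3 rfl hp, fibreSquare, add_assoc, hs]
      · by_cases hr : r = 0
        · subst hr
          rw [add_zero] at h
          obtain rfl := hV' h
          simp [hp, hV, h4 rfl hp, fibreSquare, add_assoc, hs]
        · simp only [hp, hq, hr, if_false, false_implies, true_and, ne_eq, not_false_eq_true,
            true_implies]
          refine ⟨by rw [← h]; abel, ?_⟩
          have h6 : s p + s q + s r = 0 := by rw [← map_add, ← map_add, h, map_zero]
          have := congrArg₂ (· + ·) (h5 hp hq hr) h6
          simp only [add_zero] at this
          rw [← this]; abel
  exists_rel := by
    have hV' : ∀ {p q : V}, p + q = 0 → q = p := fun {p q} h => by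
      rw [← hV p] at h; exact add_left_cancel h
    rintro ⟨p, a⟩ ⟨q, b⟩
    by_cases hp : p = 0
    · subst hp
      by_cases hq : q = 0
      · subst hq
        exact ⟨(0, -(a + b)), by simp⟩
      · exact ⟨(q, (m q).symm (a + m q b) - s q), by simp [hq, hV, fibreSquare]⟩
    · by_cases hq : q = 0
      · subst hq
        exact ⟨(p, (m p).symm (m p (a + s p) - b)), by simp [hp, hV, fibreSquare]⟩
      · by_cases hr : p = q
        · subst hr
          exact ⟨(0, fibreSquare s m p a b), by simp [hp, hV]⟩
        · have : p + q ≠ 0 := fun h => hr (hV' h).symm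
          refine ⟨(p + q, -(a + b)), by simp [hp, hq, this, hV]⟩
  rel_unique := by
    have hV' : ∀ {p q : V}, p + q = 0 → q = p := fun {p q} h => by
      rw [← hV p] at h; exact add_left_cancel h
    rintro ⟨p, a⟩ ⟨q, b⟩ ⟨r, c⟩ ⟨r', d⟩ ⟨h, h1, h2, h3, h4, h5⟩ ⟨k, k1, k2, k3, k4, k5⟩
    dsimp only at *
    obtain rfl : r = r' := add_left_cancel (h.trans k.symm)
    congr 1
    by_cases hp : p = 0
    · subst hp
      by_cases hq : q = 0
      · subst hq
        exact add_left_cancel ((h1 rfl rfl).trans (k1 rfl rfl).symm)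
      · have := (h2 rfl hq).symm.trans (k2 rfl hq)
        simpa [fibreSquare] using this
    · by_cases hq : q = 0
      · have := (h3 hq hp).symm.trans (k3 hq hp)
        simpa [fibreSquare] using this
      · by_cases hr : r = 0
        · exact (h4 hr hp).trans (k4 hr hp).symm
        · exact add_left_cancel ((h5 hp hq hr).trans (k5 hp hq hr).symm)
  rel_one := by
    have hs : ∀ p, s p + s p = 0 := fun p => by rw [← map_add, hV, map_zero]
    rintro ⟨p, a⟩
    by_cases hp : p = 0
    · simp [hp]
    · simp [hp, hV, fibreSquare, add_assoc, hs]

/-- The properties of the fibred loop on which the switches rely. -/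
theorem exists_fibredLoop {V : Type u} {A : Type v} [AddCommGroup V] [AddCommGroup A]
    (hV : ∀ p : V, p + p = 0) (s : V →+ A) (m : V → Equiv.Perm A) :
    ∃ S : IPTripleSystem (V × A), S.one = 0 ∧
      (∀ p a, p ≠ 0 → S.inv (p, a) = (p, a + s p)) ∧
      (∀ a b c, S.rel a b c → a.1 + b.1 + c.1 = 0) ∧
      (∀ p q r a b c, p ≠ 0 → q ≠ 0 → r ≠ 0 → p + q + r = 0 → a + b + c = 0 →
        S.rel (p, a) (q, b) (r, c)) ∧
      (∀ a b c, a + b + c = 0 → S.rel (0, a) (0, b) (0, c)) ∧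
      (∀ p a b c, p ≠ 0 → fibreSquare s m p a b = c → S.rel (p, a) (p, b) (0, c)) := by
  refine ⟨fibredLoop hV s m, rfl, fun p a hp => if_neg hp, fun _ _ _ h => h.1, ?_, ?_, ?_⟩
  · intro p q r a b c hp hq hr h h'
    simp [fibredLoop, hp, hq, hr, h, h']
  · intro a b c h
    simp [fibredLoop, h]
  · intro p a b c hp h
    simp [fibredLoop, hp, h, hV]

/-! ### Coordinates for a finite set with involution -/

section Coordinates

variable {C : Type u} [LinearOrder C] [InvolutiveInv C]

/-- The representative of the class `{x, x⁻¹}`. -/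
def invRep (x : C) : C := min x x⁻¹

theorem invRep_inv (x : C) : invRep x⁻¹ = invRep x := by
  simp [invRep, min_comm]

theorem invRep_eq_or (x : C) : invRep x = x ∨ invRep x = x⁻¹ := min_choice x x⁻¹

theorem eq_or_eq_inv_of_invRep_eq {x y : C} (h : invRep x = invRep y) : y = x ∨ y = x⁻¹ := by
  rcases invRep_eq_or x with hx | hx <;> rcases invRep_eq_or y with hy | hy <;>
    rw [hx, hy] at h
  · exact Or.inl h.symm
  · exact Or.inr (by rw [h, inv_inv])
  · exact Or.inr h.symm
  · exact Or.inl (inv_injective h).symm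

theorem eq_of_invRep_eq {x y : C} (h : invRep x = invRep y)
    (h' : invRep x = x ↔ invRep y = y) : x = y := by
  by_cases hx : invRep x = x
  · rw [← hx, h, h'.1 hx]
  · have hy := (invRep_eq_or y).resolve_left (fun hy => hx (h'.2 hy))
    have hx := (invRep_eq_or x).resolve_left hx
    exact inv_injective (by rw [← hx, h, hy])

theorem invRep_inv_eq_iff (x : C) : (invRep x)⁻¹ = invRep x ↔ x⁻¹ = x := by
  rcases invRep_eq_or x with hx | hx <;> rw [hx]
  rw [inv_inv, eq_comm]

theorem invRep_inv_ne {x : C} (hx : invRep x ≠ x) : invRep x⁻¹ = x⁻¹ := by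
  rw [invRep_inv]; exact (invRep_eq_or x).resolve_left hx

/-- The basis vector of the class `{x, x⁻¹}`. -/
def classVec (x : C) : C → ZMod 2 := Pi.single (invRep x) 1

/-- The coordinate that tells `x` from `x⁻¹`: it vanishes for the representative of the class. -/
def signVec (x : C) : C → ZMod 2 := if invRep x = x then 0 else classVec x

theorem classVec_inv (x : C) : classVec x⁻¹ = classVec x := by simp [classVec, invRep_inv]

theorem classVec_apply_invRep (x : C) : classVec x (invRep x) = 1 := by simp [classVec]

theorem classVec_apply_of_ne {x y : C} (h : invRep x ≠ invRep y) :
    classVec x (invRep y) = 0 := by simp [classVec, h.symm]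

theorem signVec_apply_of_ne {x y : C} (h : invRep x ≠ invRep y) :
    signVec x (invRep y) = 0 := by
  unfold signVec; split
  · rfl
  · exact classVec_apply_of_ne h

theorem classVec_ne_zero (x : C) : classVec x ≠ 0 := fun h => by
  have := congrFun h (invRep x)
  simp [classVec] at this

theorem signVec_eq_zero_iff (x : C) : signVec x = 0 ↔ invRep x = x := by
  unfold signVec
  split <;> simp_all [classVec_ne_zero]

theorem invRep_eq_of_classVec_eq {x y : C} (h : classVec x = classVec y) :
    invRep x = invRep y := by
  by_contra hne
  have := congrFun h (invRep x)
  rw [classVec_apply_invRep, classVec_apply_of_ne (Ne.symm hne)] at this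
  exact one_ne_zero this

theorem eq_of_signVec_eq {x y : C} (h : invRep x = invRep y) (h' : signVec x = signVec y) :
    x = y :=
  eq_of_invRep_eq h (by rw [← signVec_eq_zero_iff, ← signVec_eq_zero_iff, h'])

theorem zmod_two_add_self {ι : Type*} (p : ι → ZMod 2) : p + p = 0 :=
  funext fun _ => CharTwo.add_self_eq_zero _

theorem classVec_add_eq_iff {x y : C} : classVec x + classVec y = 0 ↔ invRep x = invRep y := by
  constructor
  · intro h
    refine invRep_eq_of_classVec_eq ?_
    rw [← zmod_two_add_self (classVec y)] at h
    exact add_right_cancel h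
  · intro h
    rw [classVec, classVec, h]; exact zmod_two_add_self _

theorem classVec_ne_add [Finite C] (x y z : C) : classVec x ≠ classVec y + classVec z := by
  have := Fintype.ofFinite C
  intro h
  have h1 : ∀ t : C, ∑ i, classVec t i = 1 := fun t => by simp [classVec]
  have := congrArg (fun p : C → ZMod 2 => ∑ i, p i) h
  simp only [Pi.add_apply, Finset.sum_add_distrib, h1] at this
  exact absurd this (by decide)

theorem classVec_add_eq_add {x y x' y' : C}
    (h : classVec x + classVec y = classVec x' + classVec y') :
    (invRep x = invRep x' ∧ invRep y = invRep y') ∨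
      (invRep x = invRep y' ∧ invRep y = invRep x') ∨
      (invRep x = invRep y ∧ invRep x' = invRep y') := by
  rcases (Pi.single_add_single_eq_single_add_single one_ne_zero one_ne_zero).1 h with
    h | h | h
  · exact Or.inl h
  · exact Or.inr (Or.inl h.2)
  · exact Or.inr (Or.inr h.2)

theorem eq_of_signVec_add_eq {x y x' y' : C} (hxy : invRep x ≠ invRep y)
    (hx : invRep x = invRep x') (hy : invRep y = invRep y')
    (h : signVec x + signVec y = signVec x' + signVec y') : x = x' := by
  refine eq_of_signVec_eq hx ?_
  have h1 := congrFun h (invRep x)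
  simp only [Pi.add_apply, signVec_apply_of_ne hxy.symm, add_zero] at h1
  rw [signVec_apply_of_ne (show invRep y' ≠ invRep x by rw [← hy]; exact hxy.symm),
    add_zero] at h1
  funext c
  by_cases hc : c = invRep x
  · rw [hc, h1]
  · have key : ∀ t : C, invRep t = invRep x → signVec t c = 0 := fun t ht => by
      unfold signVec classVec
      split <;> simp [ht, hc]
    rw [key x rfl, key x' hx.symm]

/-- The translation that inverts the elements of the fibre over `p`: it is trivial on the
coordinates of the involutions. -/
def invShift (C : Type u) [InvolutiveInv C] [DecidableEq C] :
    (C → ZMod 2) →+ (C → ZMod 2) × ZMod 2 × (C → ZMod 3) where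
  toFun p := (fun c => if c⁻¹ = c then 0 else p c, 0)
  map_zero' := by ext <;> simp
  map_add' p q := by
    ext
    · simp only [Pi.add_apply, Prod.fst_add]; split <;> simp
    · simp
    · simp

theorem invShift_classVec_of_inv_eq {x : C} (h : x⁻¹ = x) : invShift C (classVec x) = 0 := by
  refine Prod.ext (funext fun c => ?_) rfl
  change (if c⁻¹ = c then 0 else classVec x c) = 0
  split
  · rfl
  · rename_i hc
    have : c ≠ invRep x := fun h' => hc (by rw [h', invRep_inv_eq_iff, h])
    simp [classVec, this]

theorem invShift_classVec_of_inv_ne {x : C} (h : x⁻¹ ≠ x) :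
    invShift C (classVec x) = (classVec x, 0) := by
  refine Prod.ext (funext fun c => ?_) rfl
  change (if c⁻¹ = c then 0 else classVec x c) = classVec x c
  split
  · rename_i hc
    have : c ≠ invRep x := fun h' => h (by rwa [h', invRep_inv_eq_iff] at hc)
    simp [classVec, this]
  · rfl

theorem signVec_inv (x : C) :
    ((signVec x⁻¹, 0) : (C → ZMod 2) × ZMod 2 × (C → ZMod 3)) =
      (signVec x, 0) + invShift C (classVec x) := by
  by_cases h : x⁻¹ = x
  · rw [invShift_classVec_of_inv_eq h, h, add_zero]
  · rw [invShift_classVec_of_inv_ne h, Prod.mk_add_mk, add_zero]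
    congr 1
    by_cases hx : invRep x = x
    · have : invRep x⁻¹ ≠ x⁻¹ := by rw [invRep_inv, hx]; exact Ne.symm h
      simp [signVec, hx, this, classVec_inv]
    · simp [signVec, hx, invRep_inv_ne hx, zmod_two_add_self]

theorem invShift_add_ne_zero {x z : C} (hx : x⁻¹ ≠ x) (h : invRep z ≠ invRep x) :
    invShift C (classVec z + classVec x) ≠ 0 := by
  intro h0
  have := congrFun (congrArg Prod.fst h0) (invRep x)
  change (if (invRep x)⁻¹ = invRep x then 0 else (classVec z + classVec x) (invRep x)) = 0 at this
  rw [if_neg (mt (invRep_inv_eq_iff x).1 hx), Pi.add_apply, classVec_apply_of_ne h,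
    classVec_apply_invRep] at this
  exact absurd this (by decide)

/-- The vector of order three that becomes the square of `x` if `x³ = 1`. -/
def cubeVec (x : C) : C → ZMod 3 :=
  if invRep x = x then Pi.single (invRep x) 1 else -Pi.single (invRep x) 1

theorem cubeVec_apply (x : C) :
    cubeVec x (invRep x) = if invRep x = x then 1 else -1 := by
  unfold cubeVec; split <;> simp

theorem cubeVec_apply_of_ne {x y : C} (h : invRep x ≠ invRep y) : cubeVec x (invRep y) = 0 := by
  unfold cubeVec; split <;> simp [h.symm]

theorem cubeVec_injective : Function.Injective (cubeVec : C → C → ZMod 3) := by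
  intro x y h
  have h1 := congrFun h (invRep x)
  have hxy : invRep x = invRep y := by
    by_contra hne
    rw [cubeVec_apply, cubeVec_apply_of_ne (Ne.symm hne)] at h1
    split at h1 <;> exact absurd h1 (by decide)
  refine eq_of_invRep_eq hxy ?_
  have h2 : (if invRep x = x then (1 : ZMod 3) else -1) = if invRep y = y then 1 else -1 := by
    rw [← cubeVec_apply, ← cubeVec_apply, h, hxy]
  split_ifs at h2 with hx hy hy
  · exact iff_of_true hx hy
  · exact absurd h2 (by decide)
  · exact absurd h2 (by decide)
  · exact iff_of_false hx hy

theorem cubeVec_ne_zero (x : C) : cubeVec x ≠ 0 := fun h => by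
  have h1 := congrFun h (invRep x)
  rw [cubeVec_apply, Pi.zero_apply] at h1
  split at h1 <;> exact absurd h1 (by decide)

theorem zmod_three_add_self {ι : Type*} (p : ι → ZMod 3) : p + p + p = 0 :=
  funext fun i => by
    have : ∀ a : ZMod 3, a + a + a = 0 := by decide
    exact this _

end Coordinates

/-! ### Prescribing squares -/

/-- Translation by a nonzero vector `v` is conjugate to translation by the extra coordinate
vector. -/
theorem exists_perm_add {C : Type u} {W : Type v} [AddCommGroup W] {v : C → ZMod 2} (hv : v ≠ 0) :
    ∃ m : Equiv.Perm ((C → ZMod 2) × ZMod 2 × W), ∀ a, m (a + (v, 0)) = m a + (0, 1, 0) := by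
  obtain ⟨j, hj⟩ := Function.ne_iff.1 hv
  have hj : v j = 1 := by
    have : ∀ a : ZMod 2, a ≠ 0 → a = 1 := by decide
    exact this _ hj
  have h3 : ∀ a b : ZMod 2, a + (a + b) = b := by decide
  -- The linear involution that exchanges the `j`-th coordinate and the extra one.
  let g : (C → ZMod 2) × ZMod 2 × W → (C → ZMod 2) × ZMod 2 × W := fun a =>
    (a.1 + (a.1 j + a.2.1) • v, a.1 j, a.2.2)
  have hg : Function.Involutive g := by
    rintro ⟨a, e, t⟩
    refine Prod.ext (funext fun i => ?_) (Prod.ext ?_ rfl)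
    · simp only [g, Pi.add_apply, Pi.smul_apply, smul_eq_mul, hj, mul_one]
      have : ∀ a b c d : ZMod 2, d + (a + b) * c + (a + (a + b) + a) * c = d := by decide
      exact this _ _ _ _
    · simp only [g, Pi.add_apply, Pi.smul_apply, smul_eq_mul, hj, mul_one, h3]
  refine ⟨hg.toPerm, ?_⟩
  rintro ⟨a, e, t⟩
  refine Prod.ext (funext fun i => ?_) (Prod.ext ?_ ?_)
  · have : ∀ a b c d : ZMod 2, d + c + (a + 1 + b) * c = d + (a + b) * c := by decide
    simp [g, hj, this]
  · simp [g, hj]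
  · simp [g]

/-- The permutations that define products within a fibre can be chosen such that `x` with `x³ = 1`
has a square of order three of its own, and all elements of the other fibres without
involutions have the same square of order two. -/
theorem exists_perms {C : Type u} [LinearOrder C] [InvolutiveInv C] (Q : C → Prop)
    (hQ : ∀ x, Q x → x⁻¹ ≠ x) :
    ∃ m : (C → ZMod 2) → Equiv.Perm ((C → ZMod 2) × ZMod 2 × (C → ZMod 3)),
      (∀ x, Q x → fibreSquare (invShift C) m (classVec x) (signVec x, 0) (signVec x, 0) =
        (0, 0, cubeVec x)) ∧
      ∀ p, invShift C p ≠ 0 → (∀ x, Q x → p ≠ classVec x) →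
        ∀ a, fibreSquare (invShift C) m p a a = (0, 1, 0) := by
  classical
  have key : ∀ p : C → ZMod 2, ∃ m : Equiv.Perm ((C → ZMod 2) × ZMod 2 × (C → ZMod 3)),
      (∀ x, Q x → p = classVec x →
        m ((signVec x, 0) + invShift C p) - m (signVec x, 0) = (0, 0, cubeVec x)) ∧
      (invShift C p ≠ 0 → (∀ x, Q x → p ≠ classVec x) →
        ∀ a, m (a + invShift C p) - m a = (0, 1, 0)) := by
    intro p
    by_cases hp : ∃ x, Q x ∧ p = classVec x
    · obtain ⟨t, ht, rfl⟩ := hp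
      refine ⟨Equiv.swap (classVec t, 0) (0, 0, Pi.single (invRep t) 1), ?_,
        fun _ h => absurd rfl (h t ht)⟩
      intro x hx hxt
      have hrep := invRep_eq_of_classVec_eq hxt
      have h0 : Equiv.swap ((classVec t, 0) : (C → ZMod 2) × ZMod 2 × (C → ZMod 3))
          (0, 0, Pi.single (invRep t) 1) 0 = 0 := by
        refine Equiv.swap_apply_of_ne_of_ne ?_ ?_
        · exact fun h => classVec_ne_zero t (congrArg Prod.fst h).symm
        · intro h
          have := congrFun (congrArg (fun a => a.2.2) h) (invRep t)
          simp at this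
      rw [hxt, invShift_classVec_of_inv_ne (hQ x hx), ← hxt]
      by_cases h : invRep x = x
      · have hs : signVec x = 0 := (signVec_eq_zero_iff x).2 h
        rw [hs, show ((0, 0) : (C → ZMod 2) × ZMod 2 × (C → ZMod 3)) = 0 from rfl, zero_add, h0,
          Equiv.swap_apply_left, sub_zero, cubeVec, if_pos h, hrep]
      · have hs : signVec x = classVec t := by rw [signVec, if_neg h, hxt]
        rw [hs, Prod.mk_add_mk, zmod_two_add_self, add_zero,
          show ((0, 0) : (C → ZMod 2) × ZMod 2 × (C → ZMod 3)) = 0 from rfl, h0,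
          Equiv.swap_apply_left, cubeVec, if_neg h, hrep]
        simp
    · have hp' : ∀ x, Q x → p ≠ classVec x := fun x hx h => hp ⟨x, hx, h⟩
      by_cases hs : invShift C p = 0
      · exact ⟨1, fun x hx h => absurd h (hp' x hx), fun h => absurd hs h⟩
      · have hs1 : (invShift C p).1 ≠ 0 := fun h => hs (Prod.ext h rfl)
        obtain ⟨m, hm⟩ := exists_perm_add (W := C → ZMod 3) hs1
        refine ⟨m, fun x hx h => absurd h (hp' x hx), fun _ _ a => ?_⟩
        have : invShift C p = ((invShift C p).1, 0) := rfl
        rw [this, hm, add_sub_cancel_left]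
  choose m hm using key
  exact ⟨m, fun x hx => (hm _).1 x hx rfl, fun p => (hm p).2⟩

/-! ### Realizing the relations of a group in a finite IP loop -/

/-- A finite set `C` with an involution and with relations `x y z = 1` that behave like those among
the nontrivial elements of a group can be mapped injectively into a finite IP loop such that the
relations hold. -/
theorem exists_finite_tripleSystem {C : Type u} [Finite C] [InvolutiveInv C]
    (P : C → C → C → Prop)
    (hrot : ∀ {x y z}, P x y z → P y z x) (hrev : ∀ {x y z}, P x y z → P z⁻¹ y⁻¹ x⁻¹)
    (huniq : ∀ {x y z z'}, P x y z → P x y z' → z = z')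
    (hne : ∀ {x y z}, P x y z → y ≠ x⁻¹)
    (htwist : ∀ {x y}, P x y y → P y x x → x = y) :
    ∃ (B : Type u) (_ : Finite B) (S : IPTripleSystem B) (f : C → B),
      Function.Injective f ∧ (∀ x, f x ≠ S.one) ∧ (∀ x, f x⁻¹ = S.inv (f x)) ∧
        ∀ {x y z}, P x y z → S.rel (f x) (f y) (f z) := by
  let _ : LinearOrder C :=
    LinearOrder.lift' (Finite.equivFin C) (Finite.equivFin C).injective
  obtain ⟨m, hm3, hm2⟩ := exists_perms (fun x : C => P x x x) fun x hx h => hne hx h.symm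
  have hV : ∀ p : C → ZMod 2, p + p = 0 := zmod_two_add_self
  obtain ⟨S, hSone, hSinv', hSfst, hSline, hSzero, hSsq⟩ := exists_fibredLoop hV (invShift C) m
  let f : C → (C → ZMod 2) × (C → ZMod 2) × ZMod 2 × (C → ZMod 3) :=
    fun x => (classVec x, signVec x, 0)
  have hf : Function.Injective f := fun x y h =>
    eq_of_signVec_eq (invRep_eq_of_classVec_eq (congrArg Prod.fst h))
      (congrArg (fun a => a.2.1) h)
  have hfinv : ∀ x, f x⁻¹ = S.inv (f x) := fun x => by
    rw [hSinv' _ _ (classVec_ne_zero x), ← signVec_inv, ← classVec_inv]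
  have hf1 : ∀ x, f x ≠ S.one := fun x h => by
    rw [hSone] at h
    exact classVec_ne_zero x (congrArg Prod.fst h)
  -- In a relation, elements of one class are equal.
  have heq : ∀ {x y z}, P x y z → invRep x = invRep y → y = x := fun h h' =>
    (eq_or_eq_inv_of_invRep_eq h').resolve_right (hne h)
  have hline : ∀ {x y}, invRep x ≠ invRep y →
      S.third (f x) (f y) = (classVec x + classVec y, signVec x + signVec y, 0) := by
    intro x y h
    refine IPTripleSystem.third_eq (hSline _ _ _ _ _ _ (classVec_ne_zero x)
      (classVec_ne_zero y) (fun h' => h (classVec_add_eq_iff.1 h')) (hV _) ?_)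
    rw [Prod.mk_add_mk, Prod.mk_add_mk, hV, add_zero, add_zero]; rfl
  have hcube : ∀ {x}, P x x x → S.third (f x) (f x) = (0, 0, 0, cubeVec x) := fun h =>
    IPTripleSystem.third_eq (hSsq _ _ _ _ (classVec_ne_zero _) (hm3 _ h))
  have hsquare : ∀ {x z}, P x x z → z ≠ x → S.third (f x) (f x) = (0, 0, 1, 0) := by
    intro x z h hz
    refine IPTripleSystem.third_eq (hSsq _ _ _ _ (classVec_ne_zero x) (hm2 _ ?_ ?_ _))
    · rw [invShift_classVec_of_inv_ne fun h' => hne h h'.symm]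
      exact fun h' => classVec_ne_zero x (congrArg Prod.fst h')
    · intro t ht hxt
      rcases eq_or_eq_inv_of_invRep_eq (invRep_eq_of_classVec_eq hxt) with rfl | rfl
      · exact hz (huniq h ht)
      · refine hz (huniq h ?_)
        simpa using hrev ht
  -- The fourth triple to be removed, for the relation `x² z = 1`.
  have hopp2 : ∀ {x z}, P x x z → z ≠ x →
      S.rel (S.third (f z) (f x)) (S.third (f x) (f x)) (S.third (f x) (f z)) := by
    intro x z h hz
    have hzx : invRep z ≠ invRep x := fun h' => hz (heq (hrot h) h'.symm)
    rw [hline hzx, hline hzx.symm, hsquare h hz, add_comm (classVec x), add_comm (signVec x)]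
    refine S.rot (hSsq _ _ _ _
      (fun h' => hzx (classVec_add_eq_iff.1 h')) (hm2 _ ?_ ?_ _))
    · exact invShift_add_ne_zero (fun h' => hne h h'.symm) hzx
    · exact fun t _ h' => classVec_ne_add t z x h'.symm
  obtain ⟨S', hS1, hSinv, hS'⟩ := S.exists_switch (P := P) (f := f) hrot hrev huniq hf hfinv hf1
    (by
      intro x y z h
      by_cases hxy : invRep x = invRep y
      · obtain rfl := heq h hxy
        by_cases hz : z = y
        · subst hz
          rw [hcube h]
          refine hSzero _ _ _ ?_
          simp only [Prod.mk_add_mk, add_zero, zmod_three_add_self]; rfl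
        · exact hopp2 h hz
      · by_cases hyz : invRep y = invRep z
        · obtain rfl := heq (hrot h) hyz
          exact S.rot (S.rot (hopp2 (hrot h) fun h' => hxy (by rw [h'])))
        · by_cases hzx : invRep z = invRep x
          · obtain rfl := heq (hrot (hrot h)) hzx
            exact S.rot (hopp2 (hrot (hrot h)) fun h' => hxy (by rw [h']))
          · rw [hline hxy, hline hyz, hline hzx]
            refine hSline _ _ _ _ _ _ (fun h' => hzx (classVec_add_eq_iff.1 h'))
              (fun h' => hxy (classVec_add_eq_iff.1 h'))
              (fun h' => hyz (classVec_add_eq_iff.1 h')) ?_ ?_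
            · have := congrArg₂ (· + ·) (congrArg₂ (· + ·) (hV (classVec x)) (hV (classVec y)))
                (hV (classVec z))
              simp only [add_zero] at this
              rw [← this]; abel
            · have := congrArg₂ (· + ·) (congrArg₂ (· + ·) (hV (signVec x)) (hV (signVec y)))
                (hV (signVec z))
              simp only [add_zero] at this
              refine Prod.ext ?_ (by simp)
              simp only [Prod.fst_add, Prod.fst_zero]
              rw [← this]; abel)
    (by
      intro x y z h
      by_cases hxy : invRep x = invRep y
      · obtain rfl := heq h hxy
        by_cases hz : z = y
        · subst hz
          rw [hcube h]
          rw [hSone]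
          exact fun h' => cubeVec_ne_zero z (congrArg (fun a => a.2.2.2) h')
        · rw [hsquare h hz]
          rw [hSone]
          exact fun h' => one_ne_zero (α := ZMod 2) (congrArg (fun a => a.2.2.1) h')
      · rw [hline hxy, hSone]
        exact fun h' => hxy (classVec_add_eq_iff.1 (congrArg Prod.fst h')))
    (by
      intro x y z t h
      by_cases hxy : invRep x = invRep y
      · obtain rfl := heq h hxy
        by_cases hz : z = y
        · subst hz
          rw [hcube h]
          exact fun h' => classVec_ne_zero t (congrArg Prod.fst h')
        · rw [hsquare h hz]
          exact fun h' => classVec_ne_zero t (congrArg Prod.fst h')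
      · rw [hline hxy]
        exact fun h' => classVec_ne_add t x y (congrArg Prod.fst h'))
    (by
      -- Equality of the fibres leaves only the coincidences of two relations
      -- `x y y = 1` and `y x x = 1`.
      have hfst : ∀ x y, (S.third (f x) (f y)).1 = classVec x + classVec y := by
        intro x y
        have h1 := hSfst _ _ _ (S.rel_third (f x) (f y))
        change classVec x + classVec y + _ = 0 at h1
        rw [← hV (classVec x + classVec y)] at h1
        exact add_left_cancel h1
      have hcoinc : ∀ {x y x' y'}, S.third (f x) (f y) = S.third (f x') (f y') →
          (x = x' ∧ y = y') ∨ (x = y' ∧ y = x') ∨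
            (invRep x = invRep y ∧ invRep x' = invRep y') := by
        intro x y x' y' h
        by_cases hxy : invRep x = invRep y
        · have h1 := congrArg Prod.fst h
          rw [hfst, hfst, classVec_add_eq_iff.2 hxy, eq_comm, classVec_add_eq_iff] at h1
          exact Or.inr (Or.inr ⟨hxy, h1⟩)
        · have h1 := congrArg Prod.fst h
          rw [hfst, hfst] at h1
          have hxy' : invRep x' ≠ invRep y' := fun h' => hxy (by
            rwa [classVec_add_eq_iff.2 h', classVec_add_eq_iff] at h1)
          rw [hline hxy, hline hxy'] at h
          have h2 : signVec x + signVec y = signVec x' + signVec y' :=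
            congrArg (fun a => a.2.1) h
          rcases classVec_add_eq_add h1 with ⟨hx, hy⟩ | ⟨hx, hy⟩ | ⟨hx, -⟩
          · refine Or.inl ⟨eq_of_signVec_add_eq hxy hx hy h2, ?_⟩
            rw [add_comm, add_comm (signVec x')] at h2
            exact eq_of_signVec_add_eq (Ne.symm hxy) hy hx h2
          · rw [add_comm (signVec x')] at h2
            refine Or.inr (Or.inl ⟨eq_of_signVec_add_eq hxy hx hy h2, ?_⟩)
            rw [add_comm, add_comm (signVec y')] at h2
            exact eq_of_signVec_add_eq (Ne.symm hxy) hy hx h2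
          · exact absurd hx hxy
      intro x y z x' y' z' h h' h1 h2
      rcases hcoinc h1 with ⟨-, e⟩ | ⟨rfl, rfl⟩ | ⟨e, e'⟩
      · exact e
      · rcases hcoinc h2 with ⟨e, -⟩ | ⟨rfl, rfl⟩ | ⟨e, e'⟩
        · exact e
        · exact htwist h h'
        · obtain rfl := heq h e
          obtain rfl := heq h' e'
          exact htwist (hrot (hrot h')) (hrot (hrot h))
      · obtain rfl := heq (hrot (hrot h)) e
        obtain rfl := heq (hrot (hrot h')) e'
        rcases hcoinc h2 with ⟨e, -⟩ | ⟨rfl, rfl⟩ | ⟨e, e'⟩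
        · exact e
        · exact htwist (hrot h') (hrot h)
        · obtain rfl := heq h e
          obtain rfl := heq h' e'
          rw [hcube h, hcube h'] at h1
          exact cubeVec_injective (congrArg (fun a => a.2.2.2) h1))
  exact ⟨_, inferInstance, S', f, hf, fun x => by rw [hS1]; exact hf1 x,
    fun x => by rw [hSinv]; exact hfinv x, hS'⟩

/-- The nontrivial elements of a symmetrized subset of a group. -/
abbrev SymmNontrivial {G : Type u} [Group G] (X : Finset G) : Type u :=
  {g : G // g ≠ 1 ∧ (g ∈ X ∨ g⁻¹ ∈ X)}

instance {G : Type u} [Group G] (X : Finset G) : InvolutiveInv (SymmNontrivial X) where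
  inv g := ⟨g.1⁻¹, inv_ne_one.2 g.2.1, by rw [inv_inv]; exact g.2.2.symm⟩
  inv_inv g := Subtype.ext (inv_inv g.1)

theorem finite_symmNontrivial {G : Type u} [Group G] (X : Finset G) :
    Finite (SymmNontrivial X) := by
  refine Set.Finite.subset (X.finite_toSet.union (X.finite_toSet.preimage
    (f := fun g : G => g⁻¹) inv_injective.injOn)) ?_
  rintro g ⟨-, h | h⟩
  · exact Or.inl h
  · exact Or.inr h

/-- Every finite piece of the multiplication table of a group embeds into a finite IP loop. -/
theorem group_locallyEmbeddable (G : Type u) [Group G] :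
    LocallyEmbeddable.{u, v} G (fun H => IsFiniteIPLoop H) := by
  classical
  intro X
  have := finite_symmNontrivial X
  obtain ⟨B, _, S, f, hf, hf1, hfinv, hP⟩ := exists_finite_tripleSystem
    (fun x y z : SymmNontrivial X => x.1 * y.1 * z.1 = 1)
    (fun {x y z} h => by
      rw [mul_assoc] at h; exact mul_eq_one_comm.1 h)
    (fun {x y z} h => by
      have h' := congrArg (·⁻¹) h
      rw [mul_inv_rev, mul_inv_rev, inv_one, ← mul_assoc] at h'
      exact h')
    (fun {x y z z'} h h' => Subtype.ext (mul_left_cancel (h.trans h'.symm)))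
    (fun {x y z} h h' => z.2.1 (by
      have h'' : x.1 * x.1⁻¹ * z.1 = 1 := by rw [h'] at h; exact h
      rwa [mul_inv_cancel, one_mul] at h''))
    (fun {x y} h h' => Subtype.ext (by
      -- From `x = y⁻²` and `y = x⁻²` follow `y³ = 1` and `x = y`.
      have hx : x.1 = (y.1 * y.1)⁻¹ := eq_inv_of_mul_eq_one_left (by rwa [← mul_assoc])
      have hy : y.1 * (x.1 * x.1) = 1 := by rwa [← mul_assoc]
      have h3 : y.1 * y.1 * y.1 = 1 := by
        rw [hx] at hy
        have := congrArg (· * (y.1 * y.1 * (y.1 * y.1))) hy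
        simpa [mul_assoc] using this.symm
      rw [hx, inv_eq_of_mul_eq_one_right h3]))
  obtain ⟨n, ⟨φ⟩⟩ := Finite.exists_equiv_fin B
  let S' : IPTripleSystem (ULift.{v} (Fin n)) := S.map (φ.trans Equiv.ulift.symm)
  let F : G → B := fun g => if h : g ≠ 1 ∧ (g ∈ X ∨ g⁻¹ ∈ X) then f ⟨g, h⟩ else S.one
  have hF1 : F 1 = S.one := dif_neg fun h => h.1 rfl
  have hF : ∀ g (h : g ≠ 1 ∧ (g ∈ X ∨ g⁻¹ ∈ X)), F g = f ⟨g, h⟩ := fun g h => dif_pos h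
  have hmul : ∀ x y, x ∈ X → y ∈ X → x * y ∈ X → F (x * y) = S.inv (S.third (F x) (F y)) := by
    intro x y hx hy hxy
    by_cases hx1 : x = 1
    · rw [hx1, one_mul, hF1, IPTripleSystem.third_eq (S.rel_one _), S.inv_inv]
    by_cases hy1 : y = 1
    · rw [hy1, mul_one, hF1, IPTripleSystem.third_eq (S.rel_right_one _), S.inv_inv]
    by_cases hxy1 : x * y = 1
    · obtain rfl : y = x⁻¹ := eq_inv_of_mul_eq_one_right hxy1
      have h := hfinv ⟨x, hx1, Or.inl hx⟩
      rw [hxy1, hF1, hF x ⟨hx1, Or.inl hx⟩, hF x⁻¹ ⟨hy1, Or.inl hy⟩]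
      rw [show f ⟨x⁻¹, _⟩ = _ from h, IPTripleSystem.third_eq (S.rel_inv_right _), S.inv_one]
    · have h := hP (x := ⟨x, hx1, Or.inl hx⟩) (y := ⟨y, hy1, Or.inl hy⟩)
        (z := ⟨x * y, hxy1, Or.inl hxy⟩⁻¹) (mul_inv_cancel (x * y))
      rw [hF x ⟨hx1, Or.inl hx⟩, hF y ⟨hy1, Or.inl hy⟩, hF _ ⟨hxy1, Or.inl hxy⟩,
        IPTripleSystem.third_eq h, hfinv, S.inv_inv]
  have hFinj : ∀ x y, x ∈ X → y ∈ X → F x = F y → x = y := by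
    intro x y hx hy h
    by_cases hx1 : x = 1
    · by_cases hy1 : y = 1
      · rw [hx1, hy1]
      · rw [hx1, hF1, hF y ⟨hy1, Or.inl hy⟩] at h
        exact absurd h.symm (hf1 _)
    · rw [hF x ⟨hx1, Or.inl hx⟩] at h
      by_cases hy1 : y = 1
      · rw [hy1, hF1] at h
        exact absurd h (hf1 _)
      · rw [hF y ⟨hy1, Or.inl hy⟩] at h
        exact congrArg Subtype.val (hf h)
  refine ⟨ULift.{v} (Fin n), S'.toMul, ⟨inferInstance, S'.isIPLoop⟩,
    fun x => φ.trans Equiv.ulift.symm (F x.1), ?_, ?_⟩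
  · intro x y h
    exact Subtype.ext (hFinj _ _ x.2 y.2 ((φ.trans Equiv.ulift.symm).injective h))
  · intro x y h
    let ψ : B ≃ ULift.{v} (Fin n) := φ.trans Equiv.ulift.symm
    have h1 : S'.rel (ψ (F x.1)) (ψ (F y.1)) (ψ (S.third (F x.1) (F y.1))) := by
      change S.rel (ψ.symm _) (ψ.symm _) (ψ.symm _)
      simp only [Equiv.symm_apply_apply]
      exact S.rel_third _ _
    change ψ (F (x.1 * y.1)) = S'.inv (S'.third (ψ (F x.1)) (ψ (F y.1)))
    rw [IPTripleSystem.third_eq h1, hmul _ _ x.2 y.2 h]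
    change _ = ψ (S.inv (ψ.symm _))
    rw [Equiv.symm_apply_apply]

/-! ### From local embeddings to an ultraproduct -/

/-- A groupoid that is locally embeddable into a class of nonempty groupoids embeds into an
ultraproduct of members of this class, taken over the finite subsets of the groupoid. -/
theorem LocallyEmbeddable.embedsIntoUltraproduct {G : Type u} [Mul G]
    {M : (H : Type v) → [Mul H] → Prop} (hM : ∀ (H : Type v) [Mul H], M H → Nonempty H)
    (h : LocallyEmbeddable.{u, v} G M) : EmbedsIntoUltraproduct.{u, v} G M := by
  classical
  choose H instH hH f hf hmul using h
  have hne : ∀ X, Nonempty (H X) := fun X => @hM (H X) (instH X) (hH X)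
  let F : G → ∀ X, H X := fun g X =>
    if h : g ∈ X then f X ⟨g, h⟩ else Classical.choice (hne X)
  have hF : ∀ (g : G) (X : Finset G) (h : g ∈ X), F g X = f X ⟨g, h⟩ := fun g X h => dif_pos h
  let U : Ultrafilter (Finset G) := Ultrafilter.of Filter.atTop
  have hU : ∀ g : G, ∀ᶠ X in (U : Filter (Finset G)), g ∈ X := fun g =>
    Ultrafilter.of_le _ ((Filter.eventually_ge_atTop {g}).mono fun X hX =>
      hX (Finset.mem_singleton_self g))
  refine ⟨Finset G, U, H, instH, hH, ⟨fun g => Quotient.mk _ (F g), fun x y => ?_⟩, ?_⟩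
  · refine Quotient.sound ?_
    filter_upwards [hU x, hU y, hU (x * y)] with X hx hy hxy
    rw [hF _ _ hxy, hF _ _ hx, hF _ _ hy]
    exact hmul X ⟨x, hx⟩ ⟨y, hy⟩ hxy
  · intro x y h
    have h1 : ∀ᶠ X in (U : Filter (Finset G)), F x X = F y X := Quotient.exact h
    obtain ⟨X, h1, hx, hy⟩ := (h1.and ((hU x).and (hU y))).exists
    rw [hF _ _ hx, hF _ _ hy] at h1
    exact congrArg Subtype.val (hf X h1)

theorem theorem2 (G : Type u) [Group G] :
    LocallyEmbeddable.{u, v} G (fun H => IsFiniteIPLoop H) ∧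
      EmbedsIntoUltraproduct.{u, v} G (fun H => IsFiniteIPLoop H) := by
  refine ⟨group_locallyEmbeddable G,
    (group_locallyEmbeddable G).embedsIntoUltraproduct fun H _ hH => ?_⟩
  obtain ⟨e, -⟩ := hH.2.exists_one
  exact ⟨e⟩
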